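/- **Setting.** Let $\mathbb B$ be a Banach lattice with positive cone $\mathbb B_+$, $N=\{1,\dots,n\}$ the set of agents, $\mathscr Y$ an arbitrary set of public projects, $c:\mathscr Y\to\mathbb B_+$ a cost function, $e_i\in\mathbb B_+$ the initial endowments, $\mathbf e=\sum_{i\in N} e_i$, and $u_i:\mathbb B_+\times\mathscr Y\to\mathbb R$ utilities such that each $u_i(\cdot,z)$ is continuous, quasi-concave and strictly monotone ($\xi\ge\zeta$, $\xi\ne\zeta$ imply $u_i(\xi,z)>u_i(\zeta,z)$). Assume the essentiality condition: for all $i$, $\xi\in\mathbb B_+$ and $y,z\in\mathscr Y$ there is $\zeta\in\mathbb B_+$ with $u_i(\zeta,z)\ge u_i(\xi,y)$, and $u_i(\xi,y)\ge u_i(0,z)$. An allocation $(x_1,\dots,x_n,y)$, with $x_i\in\mathbb B_+$ and $y\in\mathscr Y$, is *feasible* if $\sum_i x_i+c(y)=\mathbf e$, and *Pareto optimal* if it is feasible and no feasible $(\xi_1,\dots,\xi_n,z)$ has $u_i(\xi_i,z)>u_i(x_i,y)$ for all $i$. For $v\in\mathbb B$ let $L(v)=\{\xi:|\xi|\le k|v|\text{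 for some }k\ge0\}$; $v\in\mathbb B_+$ is *quasi-interior* if $L(v)$ is norm dense. The preferences of agent $i$ are *ATY-proper* at $(x_i,y)$ if for every $z\in\mathscr Y$ there is a convex set $P\subseteq\mathbb B$ with nonempty interior such that $P\cap\mathbb B_+=\{\zeta\in\mathbb B_+:u_i(\zeta,z)>u_i(x_i,y)\}$ and $\operatorname{int}P\cap\mathbb B_+\neq\emptyset$; they are *strongly ATY-proper* if, moreover, $P$ can be chosen with $\operatorname{int}P\cap\mathbb B_+\cap L(\mathbf e)\ne\emptyset$. Assume that one of the following holds: (i) $\operatorname{int}\mathbb B_+\neq\emptyset$, $\mathbf e\in\operatorname{int}\mathbb B_+$, and $\mathbf e-c(y)\in\operatorname{int}\mathbb B_+$ for all $y$; (ii) $\operatorname{int}\mathbb B_+=\emptyset$, $\mathbf e$ is quasi-interior, for every $y$ there is $\delta>0$ with $\mathbf e-c(y)\ge\delta\mathbf e$, and all agents' preferences are ATY-proper at every Pareto optimal allocation; (iii) $\mathbb B_+$ has no quasi-interior point, for every $y$ there is $\delta>0$ with $\mathbf e-c(y)\ge\delta\mathbf e$, and all agents' preferences are strongly ATY-proper at every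 Pareto optimal allocation. Let $\sigma$ be a contribution measure, i.e. for every $y\in\mathscr Y$ the map $\sigma(\cdot,y)$ is an additive $[0,1]$-valued function on the nonempty subsets of $N$ with $\sigma(N,y)=1$, and let $\rho(i,y)=\sigma(\{i\},y)$ be the corresponding cost distribution function. A feasible allocation $(x_1,\dots,x_n,y)$ is a *cost share equilibrium for $\rho$* if there is $\pi:\mathscr Y\to\mathbb B^*_+$ such that, for every $i$, $(x_i,y)$ maximizes $u_i$ on the budget set $\{(\zeta,z)\in\mathbb B_+\times\mathscr Y:\pi(z)\cdot\zeta+\rho(i,z)\,\pi(z)\cdot c(z)\le\pi(z)\cdot e_i\}$ (and belongs to it). **Theorem.** Let $(x_1,\dots,x_n,y)$ be a Pareto optimal allocation, and for every $z\in\mathscr Y$ let $(\gamma^z_1,\dots,\gamma^z_n,z)$ be a feasible allocation with $u_i(\gamma^z_i,z)\ge u_i(x_i,y)$ for all $i\in N$. Then $(x_1,\dots,x_n,y)$ is a cost share equilibrium for $\rho$ if and only if, for every $z\in\mathscr Y$ and every $\alpha\in[0,1]^n$, it is not $z$-dominated in the auxiliary economy in which agent $i$'s endowment is $\alpha_i e_i+(1-\alpha_i)\big(\gamma^z_i+\rho(i,z)c(z)\big)$,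 i.e. there are no $\xi_1,\dots,\xi_n\in\mathbb B_+$ with $$\sum_{i\in N}\xi_i+c(z)=\sum_{i\in N}\Big[\alpha_i e_i+(1-\alpha_i)\big(\gamma^z_i+\rho(i,z)c(z)\big)\Big]\quad\text{and}\quad u_i(\xi_i,z)>u_i(x_i,y)\ \text{ for all } i\in N.$$ -/

import Mathlib

namespace PublicProjects

/-- The data of an economy with agents `Fin n`, private commodity space `B` and set of public
projects `Y`: cost function, utilities and initial endowments. Utilities matter only on the
positive cone of `B`. -/
structure Economy (n : ℕ) (B Y : Type*) where
  /-- cost of each project, in private goods -/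
  c : Y → B
  /-- utility functions -/
  u : Fin n → B → Y → ℝ
  /-- initial endowments -/
  e : Fin n → B

section

variable {n : ℕ} {B Y : Type*} [NormedAddCommGroup B] [Lattice B] [NormedSpace ℝ B]

/-- The total initial endowment. -/
def Economy.total (E : Economy n B Y) : B := ∑ i, E.e i

/-- Costs and endowments are bundles in the positive cone, and utilities are desirable: for every
fixed project they are continuous, strongly monotone and quasi-concave on the positive cone. -/
structure Economy.IsAdmissible (E : Economy n B Y) : Prop where
  cost_nonneg : ∀ y, 0 ≤ E.c y
  endowment_nonneg : ∀ i, 0 ≤ E.e i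
  continuous : ∀ i z, ContinuousOn (fun ξ => E.u i ξ z) (Set.Ici 0)
  monotone : ∀ i z (ξ ζ : B), 0 ≤ ζ → ζ ≤ ξ → ξ ≠ ζ → E.u i ζ z < E.u i ξ z
  quasiconcave : ∀ i z, QuasiconcaveOn ℝ (Set.Ici 0) (fun ξ => E.u i ξ z)

/-- The essentiality condition. -/
structure Economy.Essentiality (E : Economy n B Y) : Prop where
  compensation : ∀ i (ξ : B) (y z : Y), 0 ≤ ξ → ∃ ζ : B, 0 ≤ ζ ∧ E.u i ξ y ≤ E.u i ζ z
  indispensability : ∀ i (ξ : B) (y z : Y), 0 ≤ ξ → E.u i 0 z ≤ E.u i ξ y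

/-- Feasible allocations. -/
def Economy.Feasible (E : Economy n B Y) (x : Fin n → B) (y : Y) : Prop :=
  (∀ i, 0 ≤ x i) ∧ ∑ i, x i + E.c y = ∑ i, E.e i

/-- Pareto optimality: feasible, and no feasible allocation is strictly better for all agents. -/
def Economy.ParetoOptimal (E : Economy n B Y) (x : Fin n → B) (y : Y) : Prop :=
  E.Feasible x y ∧
    ¬ ∃ (ξ : Fin n → B) (z : Y), E.Feasible ξ z ∧ ∀ i, E.u i (x i) y < E.u i (ξ i) z

/-- A contribution measure: for each project, a `[0,1]`-valued additive function on the nonempty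
coalitions that gives the grand coalition the value `1`. Values at `∅` are irrelevant. -/
structure IsContributionMeasure (σ : Finset (Fin n) → Y → ℝ) : Prop where
  mem_Icc : ∀ S : Finset (Fin n), S.Nonempty → ∀ y, σ S y ∈ Set.Icc (0 : ℝ) 1
  additive : ∀ S T : Finset (Fin n), S.Nonempty → T.Nonempty → Disjoint S T →
    ∀ y, σ (S ∪ T) y = σ S y + σ T y
  univ : ∀ y, σ Finset.univ y = 1

/-- The cost distribution function of a contribution measure. -/
def costShare (σ : Finset (Fin n) → Y → ℝ) (i : Fin n) (y : Y) : ℝ := σ {i} y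

/-- The budget set of agent `i` under the price system `π` and the cost distribution `ρ`. -/
def Economy.budget (E : Economy n B Y) (ρ : Fin n → Y → ℝ) (π : Y → (B →L[ℝ] ℝ)) (i : Fin n) :
    Set (B × Y) :=
  {p | 0 ≤ p.1 ∧ π p.2 p.1 + ρ i p.2 * π p.2 (E.c p.2) ≤ π p.2 (E.e i)}

/-- Cost share equilibria whose cost distribution function is `ρ`. -/
def Economy.IsCostShareEquilibrium (E : Economy n B Y) (ρ : Fin n → Y → ℝ)
    (x : Fin n → B) (y : Y) : Prop :=
  E.Feasible x y ∧
    ∃ π : Y → (B →L[ℝ] ℝ), (∀ z (ξ : B), 0 ≤ ξ → 0 ≤ π z ξ) ∧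
      ∀ i, (x i, y) ∈ E.budget ρ π i ∧
        ∀ p ∈ E.budget ρ π i, E.u i p.1 p.2 ≤ E.u i (x i) y

/-- The auxiliary economy in direction `(ξ, z)`: agent `i` now owns
`αᵢ eᵢ + (1 - αᵢ)(ξᵢ + ρ(i,z) c(z))`; nothing else changes. -/
def Economy.auxiliary (E : Economy n B Y) (ρ : Fin n → Y → ℝ) (ξ : Fin n → B) (z : Y)
    (α : Fin n → ℝ) : Economy n B Y :=
  { E with e := fun i => α i • E.e i + (1 - α i) • (ξ i + ρ i z • E.c z) }

/-- `(x, y)` is `z`-dominated in `E`: with its total endowment, the grand coalition can provide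
the project `z` and make every agent strictly better off than at `(x, y)`. -/
def Economy.ZDominated (E : Economy n B Y) (x : Fin n → B) (y z : Y) : Prop :=
  ∃ ξ : Fin n → B, E.Feasible ξ z ∧ ∀ i, E.u i (x i) y < E.u i (ξ i) z

/-- The private bundles that, together with project `z`, agent `i` strictly prefers to `(ξ, y)`. -/
def Economy.preferred (E : Economy n B Y) (i : Fin n) (ξ : B) (y z : Y) : Set B :=
  {ζ | 0 ≤ ζ ∧ E.u i ξ y < E.u i ζ z}

/-- The principal (order) ideal generated by `v`, as a set. -/
def principalIdeal (v : B) : Set B := {ξ | ∃ k : ℝ, 0 ≤ k ∧ |ξ| ≤ k • |v|}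

/-- Quasi-interior points of the positive cone: the principal ideal is norm dense. -/
def IsQuasiInterior (v : B) : Prop := 0 ≤ v ∧ Dense (principalIdeal v)

/-- ATY-properness of the preferences of agent `i` at `(ξ, y)`. -/
def Economy.ATYProperAt (E : Economy n B Y) (i : Fin n) (ξ : B) (y : Y) : Prop :=
  ∀ z : Y, ∃ P : Set B, Convex ℝ P ∧ (interior P).Nonempty ∧
    P ∩ Set.Ici 0 = E.preferred i ξ y z ∧ (interior P ∩ Set.Ici 0).Nonempty

/-- Strong ATY-properness of the preferences of agent `i` at `(ξ, y)`. -/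
def Economy.StronglyATYProperAt (E : Economy n B Y) (i : Fin n) (ξ : B) (y : Y) : Prop :=
  ∀ z : Y, ∃ P : Set B, Convex ℝ P ∧ (interior P).Nonempty ∧
    P ∩ Set.Ici 0 = E.preferred i ξ y z ∧
    (interior P ∩ Set.Ici 0 ∩ principalIdeal E.total).Nonempty

/-- Properness at all Pareto optimal allocations. -/
def Economy.Properness (E : Economy n B Y) : Prop :=
  ∀ (x : Fin n → B) (y : Y), E.ParetoOptimal x y → ∀ i, E.ATYProperAt i (x i) y

/-- Strong properness at all Pareto optimal allocations. -/
def Economy.StrongProperness (E : Economy n B Y) : Prop :=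
  ∀ (x : Fin n → B) (y : Y), E.ParetoOptimal x y → ∀ i, E.StronglyATYProperAt i (x i) y

/-- For every project `y`, the net endowment `e - c(y)` is an interior point of the positive cone
of the principal ideal generated by the total endowment `e`, for the order unit norm of `e`. -/
def Economy.NetEndowmentOrderUnit (E : Economy n B Y) : Prop :=
  ∀ y, ∃ δ : ℝ, 0 < δ ∧ δ • E.total ≤ E.total - E.c y

/-- The three alternative settings: the positive cone has interior points, and all net endowments
are such points; or it has none, the total endowment is a quasi-interior point, and preferences
are proper; or there is no quasi-interior point, and preferences are strongly proper. -/
def Economy.Regime (E : Economy n B Y) : Prop :=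
  ((interior (Set.Ici (0 : B))).Nonempty ∧ E.total ∈ interior (Set.Ici (0 : B)) ∧
      ∀ y, E.total - E.c y ∈ interior (Set.Ici (0 : B))) ∨
  (interior (Set.Ici (0 : B)) = ∅ ∧ IsQuasiInterior E.total ∧
      E.NetEndowmentOrderUnit ∧ E.Properness) ∨
  ((¬ ∃ v : B, IsQuasiInterior v) ∧ E.NetEndowmentOrderUnit ∧ E.StrongProperness)

end

end PublicProjects

/-! Write `e` for the total endowment and L for its principal ideal. If a price π(z) makes every
strictly preferred bundle cost more than the budget allows, then γ^z exhausts all budgets, since the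
inequalities add up to an equality. Every auxiliary endowment therefore has the same value as `e_i`,
whatever α is, and a dominating allocation would be worth more than it costs.

Conversely, fix z and put s_i = e_i - γ_i - ρ_i c(z), so that the s_i sum to 0. Let D consist of all
sums of ξ_i - γ_i - α_i s_i with ξ_i preferred and in L and α in the cube. D is convex and upward
closed in L, and non-domination keeps 0 out of it. As `e` is an order unit of L, Riesz extension
yields a positive linear p on L with p ≥ 0 on D, without any topology (`exists_linear_price`).
Varying α gives p(s_i) = 0, so each γ_i is on its budget; α = 0 shows that p supports the preferred
sets at the γ_i.

Properness makes the price continuous (`exists_continuous_price`). Each agent has a continuous g_i ≤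
p on the cone of L that supports the preferred set and agrees with p at γ_i. By the
Riesz–Kantorovich formula the g_i have a common continuous upper bound π, still below p on that
cone. They agree at Σγ_i = e - c(z) ≥ δe, hence on all of [0, e], where endowments and costs lie.
Essentiality and a positive net endowment value then make the support strict. -/

namespace PublicProjects

/-! ### Riesz–Kantorovich suprema and separation theorems in ordered spaces. -/

section Lattice

set_option linter.unusedSectionVars false

variable {B : Type*} [NormedAddCommGroup B] [Lattice B] [IsOrderedAddMonoid B]
  [NormedSpace ℝ B] [IsOrderedModule ℝ B]

/-- An additive, positively homogeneous function on the positive cone extends to a linear map. -/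
lemma exists_linearMap_eq_on_nonneg (S : B → ℝ)
    (hadd : ∀ a b, 0 ≤ a → 0 ≤ b → S (a + b) = S a + S b)
    (hsmul : ∀ (t : ℝ) a, 0 ≤ t → 0 ≤ a → S (t • a) = t * S a) :
    ∃ h : B →ₗ[ℝ] ℝ, ∀ a, 0 ≤ a → h a = S a := by
  -- `S a - S b` depends only on `a - b`, so linearity can be checked on any convenient positive
  -- decomposition.
  have key : ∀ v a b : B, 0 ≤ a → 0 ≤ b → v = a - b → S v⁺ - S v⁻ = S a - S b := by
    intro v a b ha hb hv
    have h1 : v⁺ + b = a + v⁻ := by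
      have h2 : v⁺ - v⁻ = a - b := by rw [posPart_sub_negPart, hv]
      rw [sub_eq_sub_iff_add_eq_add] at h2
      exact h2
    have h3 := congrArg S h1
    rw [hadd _ _ (posPart_nonneg v) hb, hadd _ _ ha (negPart_nonneg v)] at h3
    linarith
  refine ⟨{ toFun := fun v => S v⁺ - S v⁻, map_add' := ?_, map_smul' := ?_ }, ?_⟩
  · intro v w
    rw [key (v + w) (v⁺ + w⁺) (v⁻ + w⁻) (add_nonneg (posPart_nonneg v) (posPart_nonneg w))
      (add_nonneg (negPart_nonneg v) (negPart_nonneg w)),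
      hadd _ _ (posPart_nonneg v) (posPart_nonneg w),
      hadd _ _ (negPart_nonneg v) (negPart_nonneg w)]
    · ring
    · nth_rewrite 1 [← posPart_sub_negPart v, ← posPart_sub_negPart w]
      abel
  · intro t v
    simp only [RingHom.id_apply, smul_eq_mul]
    rcases le_total 0 t with ht | ht
    · rw [key (t • v) (t • v⁺) (t • v⁻) (smul_nonneg ht (posPart_nonneg v))
        (smul_nonneg ht (negPart_nonneg v)), hsmul _ _ ht (posPart_nonneg v),
        hsmul _ _ ht (negPart_nonneg v)]
      · ring
      · rw [← smul_sub, posPart_sub_negPart]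
    · have ht' : 0 ≤ -t := by linarith
      rw [key (t • v) ((-t) • v⁻) ((-t) • v⁺) (smul_nonneg ht' (negPart_nonneg v))
        (smul_nonneg ht' (posPart_nonneg v)), hsmul _ _ ht' (posPart_nonneg v),
        hsmul _ _ ht' (negPart_nonneg v)]
      · ring
      · rw [← smul_sub, ← neg_sub v⁺, posPart_sub_negPart, smul_neg, neg_smul, neg_neg]
  · intro a ha
    have := key a a 0 ha le_rfl (by simp)
    have h0 := hsmul 0 0 le_rfl le_rfl
    simp only [smul_zero, zero_mul] at h0
    simpa [h0] using this

open Pointwise in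
/-- The Riesz decomposition property of a lattice ordered group. -/
lemma Icc_add_Icc_of_nonneg {a b : B} (ha : 0 ≤ a) (hb : 0 ≤ b) :
    Set.Icc 0 a + Set.Icc 0 b = Set.Icc 0 (a + b) := by
  ext w
  rw [Set.mem_add]
  constructor
  · rintro ⟨v, hv, v', hv', rfl⟩
    exact ⟨add_nonneg hv.1 hv'.1, add_le_add hv.2 hv'.2⟩
  · rintro ⟨h1, h2⟩
    refine ⟨w ⊓ a, ⟨le_inf h1 ha, inf_le_right⟩, w - w ⊓ a, ⟨sub_nonneg.2 inf_le_left, ?_⟩, by abel⟩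
    rw [sub_le_iff_le_add, ← sub_le_iff_le_add']
    exact le_inf (sub_le_self _ hb) (sub_le_iff_le_add.2 h2)

open Pointwise in
lemma smul_Icc_zero {t : ℝ} (ht : 0 ≤ t) {a : B} (ha : 0 ≤ a) :
    t • Set.Icc 0 a = Set.Icc 0 (t • a) := by
  rcases ht.eq_or_lt with rfl | ht
  · rw [Set.zero_smul_set (Set.nonempty_Icc.2 ha), zero_smul, Set.Icc_self]
    rfl
  · ext w
    rw [Set.mem_smul_set_iff_inv_smul_mem₀ ht.ne', Set.mem_Icc, Set.mem_Icc,
      inv_smul_le_iff_of_pos ht, le_inv_smul_iff_of_pos ht, smul_zero]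

open Pointwise in
/-- The Riesz–Kantorovich formula for the supremum of two positive functionals. -/
lemma exists_isLUB_functional [HasSolidNorm B] (f g : B →L[ℝ] ℝ)
    (hf : ∀ a, 0 ≤ a → 0 ≤ f a) (hg : ∀ a, 0 ≤ a → 0 ≤ g a) :
    ∃ h : B →L[ℝ] ℝ, ∀ a, 0 ≤ a →
      IsLUB ((fun w => f (a - w) + g w) '' Set.Icc 0 a) (h a) := by
  -- `S` is (g - f)⁺ on the cone, and f + (g - f)⁺ is the supremum of f and g. Additivity of `S` is
  -- Riesz decomposition.
  let S : B → ℝ := fun a => sSup ((g - f) '' Set.Icc 0 a)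
  have hne : ∀ a : B, 0 ≤ a → ((g - f) '' Set.Icc 0 a).Nonempty := fun a ha =>
    Set.Nonempty.image _ ⟨0, le_rfl, ha⟩
  have hbdd : ∀ a : B, BddAbove ((g - f) '' Set.Icc 0 a) := by
    rintro a
    refine ⟨g a, ?_⟩
    rintro _ ⟨w, ⟨hw0, hwa⟩, rfl⟩
    have h1 := hf w hw0
    have h2 := hg (a - w) (sub_nonneg.2 hwa)
    simp only [map_sub, sub_apply] at h2 ⊢
    linarith
  obtain ⟨k, hk⟩ := exists_linearMap_eq_on_nonneg S
    (by
      intro a b ha hb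
      change sSup _ = sSup _ + sSup _
      rw [← Icc_add_Icc_of_nonneg ha hb, Set.image_add,
        csSup_add (hne a ha) (hbdd a) (hne b hb) (hbdd b)])
    (by
      intro t a ht ha
      change sSup _ = t * sSup _
      rw [← smul_Icc_zero ht ha, image_smul_set, Real.sSup_smul_of_nonneg ht, smul_eq_mul])
  have hlub : ∀ a, 0 ≤ a →
      IsLUB ((fun w => f (a - w) + g w) '' Set.Icc 0 a) (f a + k a) := by
    intro a ha
    rw [hk a ha]
    have h1 : IsLUB ((g - f) '' Set.Icc 0 a) (S a) := isLUB_csSup (hne a ha) (hbdd a)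
    constructor
    · rintro _ ⟨w, hw, rfl⟩
      have h2 := h1.1 ⟨w, hw, rfl⟩
      simp only [map_sub, sub_apply] at h2 ⊢
      linarith
    · intro r hr
      have h2 : S a ≤ r - f a := by
        apply h1.2
        rintro _ ⟨w, hw, rfl⟩
        have h3 := hr ⟨w, hw, rfl⟩
        simp only [map_sub, sub_apply] at h3 ⊢
        linarith
      linarith
  let l : B →ₗ[ℝ] ℝ := (f : B →ₗ[ℝ] ℝ) + k
  have hl : ∀ a, l a = f a + k a := fun a => rfl
  have hlpos : ∀ a, 0 ≤ a → 0 ≤ l a := by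
    intro a ha
    have := (hlub a ha).1 ⟨0, ⟨le_rfl, ha⟩, rfl⟩
    simp only [sub_zero, map_zero, add_zero] at this
    rw [hl]
    linarith [hf a ha]
  have hlbd : ∀ a, 0 ≤ a → l a ≤ f a + g a := by
    intro a ha
    rw [hl]
    apply (hlub a ha).2
    rintro _ ⟨w, ⟨hw0, hwa⟩, rfl⟩
    have h1 := hf w hw0
    have h2 := hg (a - w) (sub_nonneg.2 hwa)
    simp only [map_sub] at h2 ⊢
    linarith
  -- Positivity gives |l v| ≤ l |v|, which is at most (f + g) |v|; the norm is solid.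
  refine ⟨l.mkContinuous (‖f‖ + ‖g‖) ?_, fun a ha => hlub a ha⟩
  intro v
  have h1 := hlpos (|v| - v) (sub_nonneg.2 (le_abs_self v))
  have h2 := hlpos (|v| + v) (by
    have := neg_le_abs v
    rwa [neg_le_iff_add_nonneg] at this)
  have h3 := hlbd |v| (abs_nonneg v)
  have h4 := f.le_opNorm |v|
  have h5 := g.le_opNorm |v|
  rw [norm_abs_eq_norm] at h4 h5
  have h6 := le_trans (Real.le_norm_self _) h4
  have h7 := le_trans (Real.le_norm_self _) h5
  rw [map_sub] at h1
  rw [map_add] at h2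
  rw [Real.norm_eq_abs, abs_le]
  constructor <;> linarith

/-- Finitely many positive continuous functionals that are bounded by `p` on the cone of an
order ideal have a continuous upper bound with the same property. -/
lemma exists_upper_bound_le {ι : Type*} [HasSolidNorm B] (M : Set B)
    (hM : ∀ a ∈ M, ∀ b, 0 ≤ b → b ≤ a → b ∈ M) (p : B →ₗ[ℝ] ℝ)
    (hp : ∀ a ∈ M, 0 ≤ a → 0 ≤ p a) (s : Finset ι) (g : ι → B →L[ℝ] ℝ)
    (hg : ∀ i ∈ s, ∀ a, 0 ≤ a → 0 ≤ g i a) (hgp : ∀ i ∈ s, ∀ a ∈ M, 0 ≤ a → g i a ≤ p a) :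
    ∃ h : B →L[ℝ] ℝ, (∀ a, 0 ≤ a → 0 ≤ h a) ∧ (∀ i ∈ s, ∀ a, 0 ≤ a → g i a ≤ h a) ∧
      ∀ a ∈ M, 0 ≤ a → h a ≤ p a := by
  classical
  induction s using Finset.induction_on with
  | empty => exact ⟨0, by simp, by simp, fun a ha h0 => by simpa using hp a ha h0⟩
  | insert j s _ ih =>
    obtain ⟨h, h0, h1, h2⟩ := ih (fun i hi => hg i (Finset.mem_insert_of_mem hi))
      (fun i hi => hgp i (Finset.mem_insert_of_mem hi))
    have hj := Finset.mem_insert_self j s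
    obtain ⟨k, hk⟩ := exists_isLUB_functional h (g j) h0 (hg j hj)
    have hhk : ∀ a, 0 ≤ a → h a ≤ k a := fun a ha => by
      simpa using (hk a ha).1 ⟨0, ⟨le_rfl, ha⟩, rfl⟩
    refine ⟨k, fun a ha => (h0 a ha).trans (hhk a ha), ?_, ?_⟩
    · intro i hi a ha
      rcases Finset.mem_insert.1 hi with rfl | hi
      · simpa using (hk a ha).1 ⟨a, ⟨ha, le_rfl⟩, rfl⟩
      · exact (h1 i hi a ha).trans (hhk a ha)
    · intro a ha ha0
      apply (hk a ha0).2
      -- Both `w` and `a - w` stay in `M`, so each competitor in the formula is at most p(a - w) +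
      -- p(w) = p(a).
      rintro _ ⟨w, ⟨hw0, hwa⟩, rfl⟩
      have h3 := hgp j hj w (hM a ha w hw0 hwa) hw0
      have h4 := h2 (a - w) (hM a ha _ (sub_nonneg.2 hwa) (sub_le_self _ hw0)) (sub_nonneg.2 hwa)
      rw [map_sub p] at h4
      change h (a - w) + g j w ≤ p a
      linarith

/-- A convex set `D` in a subspace `M` with order unit `e` that is upward closed and does not
contain `0` is contained in a half space of a positive linear functional. -/
lemma exists_linearMap_nonneg_on (M : Submodule ℝ B) {e : B} (he : 0 ≤ e) (he0 : e ≠ 0)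
    (heM : e ∈ M) (hunit : ∀ v ∈ M, ∃ t : ℝ, 0 ≤ t • e + v) (D : Set B) (hDM : D ⊆ M)
    (hD : Convex ℝ D) (hD0 : (0 : B) ∉ D) (hup : ∀ d ∈ D, ∀ m ∈ M, 0 ≤ m → d + m ∈ D) :
    ∃ p : B →ₗ[ℝ] ℝ, p e = 1 ∧ (∀ v ∈ M, 0 ≤ v → 0 ≤ p v) ∧ ∀ d ∈ D, 0 ≤ p d := by
  have hmix : ∀ (x : B) (t : ℝ) (d : B), x ∈ M → 0 ≤ x → 0 < t → d ∈ D →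
      ∃ d' ∈ D, x + t • d = t • d' := by
    intro x t d hxM hx ht hd
    refine ⟨d + t⁻¹ • x, hup d hd _ (M.smul_mem _ hxM) (smul_nonneg (inv_nonneg.2 ht.le) hx), ?_⟩
    rw [smul_add, smul_inv_smul₀ ht.ne', add_comm]
  -- The cone generated by `D` and the positive elements of `M`; upward closedness absorbs the mixed
  -- sums. It contains no negative multiple of `e`: that would force e ≤ 0 or 0 ∈ D.
  let K : PointedCone ℝ M :=
    { carrier := {x | (0 : B) ≤ x ∨ ∃ t : ℝ, 0 < t ∧ ∃ d ∈ D, (x : B) = t • d}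
      zero_mem' := Or.inl (by simp)
      add_mem' := by
        rintro x y (hx | ⟨t, ht, d, hd, hx⟩) (hy | ⟨s, hs, d', hd', hy⟩)
        · exact Or.inl (by simpa using add_nonneg hx hy)
        · obtain ⟨d'', h1, h2⟩ := hmix x s d' x.2 hx hs hd'
          exact Or.inr ⟨s, hs, d'', h1, by rw [← h2, ← hy]; rfl⟩
        · obtain ⟨d'', h1, h2⟩ := hmix y t d y.2 hy ht hd
          exact Or.inr ⟨t, ht, d'', h1, by rw [← h2, ← hx, add_comm]; rfl⟩
        · refine Or.inr ⟨t + s, by positivity, (t / (t + s)) • d + (s / (t + s)) • d',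
            hD hd hd' (by positivity) (by positivity) (by field_simp), ?_⟩
          have : t + s ≠ 0 := by positivity
          rw [smul_add, smul_smul, smul_smul, mul_div_cancel₀ _ this, mul_div_cancel₀ _ this,
            ← hx, ← hy]
          rfl
      smul_mem' := by
        rintro ⟨r, hr⟩ x (hx | ⟨t, ht, d, hd, hx⟩)
        · exact Or.inl (smul_nonneg hr hx)
        · rcases hr.eq_or_lt with rfl | hr'
          · left
            change (0 : B) ≤ (0 : ℝ) • (x : B)
            simp
          · refine Or.inr ⟨r * t, mul_pos hr' ht, d, hd, ?_⟩
            rw [mul_smul, ← hx]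
            rfl }
  let e' : M := ⟨e, heM⟩
  have he' : e' ≠ 0 := fun h => he0 (congrArg Subtype.val h)
  obtain ⟨p, hp1, hp2⟩ := riesz_extension K (LinearPMap.mkSpanSingleton e' (1 : ℝ) he')
    (by
      rintro ⟨x, hx⟩ hxK
      obtain ⟨s, rfl⟩ := Submodule.mem_span_singleton.1 hx
      have hval : LinearPMap.mkSpanSingleton e' (1 : ℝ) he' ⟨s • e', hx⟩ = s • (1 : ℝ) :=
        LinearPMap.mkSpanSingleton'_apply e' (1 : ℝ) _ s hx
      rw [hval, smul_eq_mul, mul_one]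
      by_contra! hs
      rcases hxK with h | ⟨t, ht, d, hd, h⟩
      · apply he0
        refine le_antisymm ?_ he
        have h' : (0 : B) ≤ s • e := h
        have := smul_le_smul_of_nonneg_left h' (neg_nonneg.2 (inv_nonpos.2 hs.le))
        rwa [smul_zero, neg_smul, inv_smul_smul₀ hs.ne, neg_nonneg] at this
      · apply hD0
        have h' : s • e = t • d := h
        have h2 : d + (-(t⁻¹ * s)) • e = 0 := by
          rw [neg_smul, mul_smul, h', inv_smul_smul₀ ht.ne', add_neg_cancel]
        rw [← h2]
        refine hup d hd _ (M.smul_mem _ heM) (smul_nonneg ?_ he)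
        have := mul_neg_of_pos_of_neg (inv_pos.2 ht) hs
        linarith)
    (by
      intro v
      obtain ⟨t, ht⟩ := hunit v v.2
      exact ⟨⟨t • e', Submodule.mem_span_singleton.2 ⟨t, rfl⟩⟩, Or.inl ht⟩)
  obtain ⟨q, hq⟩ := p.exists_extend
  have hqp : ∀ v (hv : v ∈ M), q v = p ⟨v, hv⟩ := fun v hv =>
    congrArg (fun l : M →ₗ[ℝ] ℝ => l ⟨v, hv⟩) hq
  refine ⟨q, ?_, ?_, ?_⟩
  · rw [hqp e heM]
    have := hp1 ⟨e', Submodule.mem_span_singleton_self e'⟩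
    simp only at this
    change p e' = 1
    rw [this]
    exact LinearPMap.mkSpanSingleton_apply ℝ ℝ (σ := RingHom.id ℝ) he' (1 : ℝ)
  · intro v hv h0
    rw [hqp v hv]
    exact hp2 _ (Or.inl h0)
  · intro d hd
    rw [hqp d (hDM hd)]
    exact hp2 _ (Or.inr ⟨1, one_pos, d, hd, by simp⟩)

/-- If a linear functional `p` on a subspace `M` supports the trace of a convex set `Q` with
interior on the cone of `M`, then it dominates a continuous functional that supports `Q`. -/
lemma exists_continuous_support (M : Submodule ℝ B) (p : B →ₗ[ℝ] ℝ) {Q : Set B}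
    (hQ : Convex ℝ Q) (hne : (interior Q ∩ Set.Ici 0 ∩ M).Nonempty) {x : B} (hxQ : x ∈ closure Q)
    (hx : 0 ≤ x) (hxM : x ∈ M) (hp : ∀ k ∈ Q, k ∈ M → 0 ≤ k → p x ≤ p k) :
    ∃ g : B →L[ℝ] ℝ, (∀ q ∈ Q, g x ≤ g q) ∧ (∀ k ∈ M, 0 ≤ k → g k ≤ p k) ∧ g x = p x := by
  obtain ⟨w, ⟨hwQ, hw0⟩, hwM⟩ := hne
  -- Separate an open cylinder below height `p x` from the epigraph of `p` over the cone of `M`; the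
  -- slope of the hyperplane is the functional sought.
  let U : Set (B × ℝ) := interior Q ×ˢ Set.Iio (p x)
  let V : Set (B × ℝ) := {k | 0 ≤ k.1 ∧ k.1 ∈ M ∧ p k.1 ≤ k.2}
  have hV : Convex ℝ V := by
    rintro ⟨a, r⟩ ⟨ha, haM, har⟩ ⟨b, s⟩ ⟨hb, hbM, hbs⟩ α β hα hβ _
    refine ⟨add_nonneg (smul_nonneg hα ha) (smul_nonneg hβ hb),
      M.add_mem (M.smul_mem _ haM) (M.smul_mem _ hbM), ?_⟩
    simp only [Prod.smul_mk, Prod.mk_add_mk, map_add, map_smul, smul_eq_mul] at har hbs ⊢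
    exact add_le_add (mul_le_mul_of_nonneg_left har hα) (mul_le_mul_of_nonneg_left hbs hβ)
  have hdisj : Disjoint U V := by
    rw [Set.disjoint_left]
    rintro ⟨a, r⟩ ⟨ha, hr⟩ ⟨ha0, haM, har⟩
    have := hp a (interior_subset ha) haM ha0
    simp only [Set.mem_Iio] at hr har
    linarith
  obtain ⟨f, u, hfU, hfV⟩ := geometric_hahn_banach_open
    (hQ.interior.prod (convex_Iio (p x))) (isOpen_interior.prod isOpen_Iio) hV hdisj
  have hf : ∀ a r, f (a, r) = f (a, 0) + r * f (0, 1) := by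
    intro a r
    have : ((a, r) : B × ℝ) = (a, 0) + r • (0, 1) := by simp
    rw [this, map_add, map_smul, smul_eq_mul]
  have hlt : ∀ q ∈ interior Q, ∀ s, s < p x → ∀ k ∈ M, 0 ≤ k →
      f (q, 0) + s * f (0, 1) < f (k, 0) + p k * f (0, 1) := by
    intro q hq s hs k hk hk0
    have h1 := hfU (q, s) ⟨hq, hs⟩
    have h2 := hfV (k, p k) ⟨hk0, hk, le_rfl⟩
    rw [hf] at h1 h2
    linarith
  -- The hyperplane is not vertical, because `w` lies under both sets.
  have hpos : 0 < f (0, 1) := by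
    have h1 := hlt w hwQ (p x - 1) (by linarith) w hwM hw0
    have h2 := hp w (interior_subset hwQ) hwM hw0
    nlinarith
  let g : B →L[ℝ] ℝ := (-(f (0, 1))⁻¹) • f.comp (ContinuousLinearMap.inl ℝ B ℝ)
  have hg : ∀ a, f (a, 0) = - f (0, 1) * g a := by
    intro a
    change f (a, 0) = - f (0, 1) * (-(f (0, 1))⁻¹ * f (a, 0))
    field_simp
  have hle : ∀ k ∈ M, 0 ≤ k → ∀ q ∈ interior Q, p x - g q ≤ p k - g k := by
    intro k hk hk0 q hq
    refine le_of_forall_pos_le_add fun ε hε => ?_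
    have h1 := hlt q hq (p x - ε) (by linarith) k hk hk0
    rw [hg, hg] at h1
    have h2 : f (0, 1) * (p x - ε - g q) < f (0, 1) * (p k - g k) := by linarith
    have := lt_of_mul_lt_mul_left h2 hpos.le
    linarith
  have hle' : ∀ k ∈ M, 0 ≤ k → ∀ q ∈ closure Q, p x - g q ≤ p k - g k := by
    intro k hk hk0 q hq
    rw [← hQ.closure_interior_eq_closure_of_nonempty_interior ⟨w, hwQ⟩] at hq
    exact closure_minimal (s := interior Q) (t := {q | p x - g q ≤ p k - g k}) (hle k hk hk0)
      (isClosed_le (by fun_prop) (by fun_prop)) hq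
  -- Testing at 0 and 2x bounds p x - g x from both sides by 0.
  have hxx : g x = p x := by
    have h1 := hle' 0 M.zero_mem le_rfl x hxQ
    have h2 := hle' ((2 : ℝ) • x) (M.smul_mem _ hxM) (smul_nonneg zero_le_two hx) x hxQ
    simp only [map_smul, map_zero, smul_eq_mul] at h1 h2
    linarith
  refine ⟨g, fun q hq => ?_, fun k hk hk0 => ?_, hxx⟩
  · have := hle' x hxM hx q (subset_closure hq)
    linarith
  · have := hle' k hk hk0 x hxQ
    linarith

end Lattice

end PublicProjects

namespace PublicProjects

/-! ### Supporting prices: algebraic on the ideal, then continuous. -/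

section Pricing

set_option linter.unusedSectionVars false

variable {n : ℕ} {B Y : Type*} [NormedAddCommGroup B] [Lattice B] [IsOrderedAddMonoid B]
  [NormedSpace ℝ B] [IsOrderedModule ℝ B]

/-- The principal ideal as a subspace. -/
def idealSubmodule (e : B) : Submodule ℝ B where
  carrier := principalIdeal e
  zero_mem' := ⟨0, le_rfl, by simp⟩
  add_mem' := by
    rintro a b ⟨k, hk, ha⟩ ⟨l, hl, hb⟩
    refine ⟨k + l, add_nonneg hk hl, (abs_add_le a b).trans ?_⟩
    rw [add_smul]
    exact add_le_add ha hb
  smul_mem' := by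
    rintro t a ⟨k, hk, ha⟩
    refine ⟨|t| * k, mul_nonneg (abs_nonneg t) hk, ?_⟩
    rw [mul_smul]
    refine le_trans ?_ (smul_le_smul_of_nonneg_left ha (abs_nonneg t))
    rcases le_total 0 t with ht | ht
    · rw [abs_of_nonneg ht, abs_le']
      exact ⟨smul_le_smul_of_nonneg_left (le_abs_self a) ht,
        smul_neg t a ▸ smul_le_smul_of_nonneg_left (neg_le_abs a) ht⟩
    · have ht' : 0 ≤ -t := neg_nonneg.2 ht
      rw [abs_of_nonpos ht, abs_le']
      exact ⟨neg_smul_neg t a ▸ smul_le_smul_of_nonneg_left (neg_le_abs a) ht',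
        neg_smul t a ▸ smul_le_smul_of_nonneg_left (le_abs_self a) ht'⟩

lemma mem_principalIdeal_of_le {e a b : B} (ha : a ∈ principalIdeal e) (hb : 0 ≤ b)
    (hba : b ≤ a) : b ∈ principalIdeal e := by
  obtain ⟨k, hk, h⟩ := ha
  refine ⟨k, hk, le_trans ?_ h⟩
  rw [abs_of_nonneg hb]
  exact hba.trans (le_abs_self a)

lemma self_mem_principalIdeal (e : B) : e ∈ principalIdeal e := ⟨1, zero_le_one, by simp⟩

lemma Economy.preferred_convex {E : Economy n B Y} (hE : E.IsAdmissible) (i : Fin n) (ξ : B)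
    (y z : Y) : Convex ℝ (E.preferred i ξ y z) :=
  (hE.quasiconcave i z).convex_gt (E.u i ξ y)

lemma Economy.add_mem_preferred {E : Economy n B Y} (hE : E.IsAdmissible) {i : Fin n} {ξ ζ m : B}
    {y z : Y} (hζ : ζ ∈ E.preferred i ξ y z) (hm : 0 ≤ m) : ζ + m ∈ E.preferred i ξ y z := by
  rcases eq_or_ne m 0 with rfl | h0
  · simpa using hζ
  · exact ⟨add_nonneg hζ.1 hm, hζ.2.trans
      (hE.monotone i z _ _ hζ.1 (le_add_of_nonneg_right hm) (by simpa using h0))⟩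

lemma Economy.add_mem_preferred_of_le {E : Economy n B Y} (hE : E.IsAdmissible) {i : Fin n}
    {ξ ζ m : B} {y z : Y} (hζ : 0 ≤ ζ) (h : E.u i ξ y ≤ E.u i ζ z) (hm : 0 ≤ m) (h0 : m ≠ 0) :
    ζ + m ∈ E.preferred i ξ y z :=
  ⟨add_nonneg hζ hm, h.trans_lt
    (hE.monotone i z _ _ hζ (le_add_of_nonneg_right hm) (by simpa using h0))⟩

/-- Undominated allocations are supported by an algebraic price on the ideal of the total
endowment. -/
lemma Economy.exists_linear_price [Nonempty (Fin n)] {E : Economy n B Y} (hE : E.IsAdmissible)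
    {x : Fin n → B} {y z : Y} {ρ : Fin n → Y → ℝ} (hρ : ∑ i, ρ i z = 1) {γ : Fin n → B}
    (hγ : E.Feasible γ z) (hγu : ∀ i, E.u i (x i) y ≤ E.u i (γ i) z) (he0 : E.total ≠ 0)
    (hnd : ∀ α : Fin n → ℝ, (∀ i, α i ∈ Set.Icc (0 : ℝ) 1) →
      ¬ (E.auxiliary ρ γ z α).ZDominated x y z) :
    ∃ p : B →ₗ[ℝ] ℝ, p E.total = 1 ∧ (∀ v ∈ principalIdeal E.total, 0 ≤ v → 0 ≤ p v) ∧
      (∀ i, p (γ i) + ρ i z * p (E.c z) = p (E.e i)) ∧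
      ∀ i, ∀ ξ ∈ E.preferred i (x i) y z, ξ ∈ principalIdeal E.total → p (γ i) ≤ p ξ := by
  classical
  obtain ⟨hγ0, hγs⟩ := hγ
  have he : 0 ≤ E.total := Finset.sum_nonneg fun i _ => hE.endowment_nonneg i
  have hle : ∀ b, 0 ≤ b → b ≤ E.total → b ∈ idealSubmodule E.total := fun b hb hbe =>
    mem_principalIdeal_of_le (self_mem_principalIdeal _) hb hbe
  have heM : E.total ∈ idealSubmodule E.total := self_mem_principalIdeal _
  have hei : ∀ i, E.e i ∈ idealSubmodule E.total := fun i => hle _ (hE.endowment_nonneg i)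
    (Finset.single_le_sum (f := E.e) (fun j _ => hE.endowment_nonneg j) (Finset.mem_univ i))
  have hc : E.c z ∈ idealSubmodule E.total := hle _ (hE.cost_nonneg z) (by
    change _ ≤ ∑ i, E.e i
    rw [← hγs]
    exact le_add_of_nonneg_left (Finset.sum_nonneg fun i _ => hγ0 i))
  have hγM : ∀ i, γ i ∈ idealSubmodule E.total := fun i => hle _ (hγ0 i) (by
    change _ ≤ ∑ i, E.e i
    rw [← hγs]
    exact (Finset.single_le_sum (f := γ) (fun j _ => hγ0 j) (Finset.mem_univ i)).trans
      (le_add_of_nonneg_right (hE.cost_nonneg z)))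
  let s : Fin n → B := fun i => E.e i - γ i - ρ i z • E.c z
  have hsM : ∀ i, s i ∈ idealSubmodule E.total := fun i =>
    Submodule.sub_mem _ (Submodule.sub_mem _ (hei i) (hγM i)) (Submodule.smul_mem _ _ hc)
  have hs0 : ∑ i, s i = 0 := by
    simp only [s, Finset.sum_sub_distrib, ← Finset.sum_smul, hρ, one_smul, ← hγs]
    abel
  let D : Set B := {d | ∃ (ξ : Fin n → B) (α : Fin n → ℝ), (∀ i, α i ∈ Set.Icc (0 : ℝ) 1) ∧
    (∀ i, ξ i ∈ E.preferred i (x i) y z ∧ ξ i ∈ idealSubmodule E.total) ∧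
    d = ∑ i, (ξ i - γ i - α i • s i)}
  obtain ⟨i₀⟩ := ‹Nonempty (Fin n)›
  obtain ⟨p, hpe, hpM, hpD⟩ := exists_linearMap_nonneg_on (idealSubmodule E.total) he he0 heM
    (by
      rintro v ⟨k, -, hv⟩
      refine ⟨k, ?_⟩
      rw [abs_of_nonneg he] at hv
      have := (neg_le_abs v).trans hv
      rwa [neg_le_iff_add_nonneg] at this) D
    (by
      rintro d ⟨ξ, α, -, hξ, rfl⟩
      exact Submodule.sum_mem _ fun i _ => Submodule.sub_mem _
        (Submodule.sub_mem _ (hξ i).2 (hγM i)) (Submodule.smul_mem _ _ (hsM i)))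
    (by
      rintro d ⟨ξ, α, hα, hξ, rfl⟩ d' ⟨ξ', α', hα', hξ', rfl⟩ a b ha hb hab
      refine ⟨fun i => a • ξ i + b • ξ' i, fun i => a * α i + b * α' i, fun i => ?_, fun i => ?_, ?_⟩
      · exact convex_Icc (0 : ℝ) 1 (hα i) (hα' i) ha hb hab
      · exact ⟨E.preferred_convex hE i (x i) y z (hξ i).1 (hξ' i).1 ha hb hab,
          Submodule.add_mem _ (Submodule.smul_mem _ _ (hξ i).2) (Submodule.smul_mem _ _ (hξ' i).2)⟩
      · rw [Finset.smul_sum, Finset.smul_sum, ← Finset.sum_add_distrib]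
        obtain rfl : b = 1 - a := by linarith
        refine Finset.sum_congr rfl fun i _ => ?_
        module)
    (by
      -- A representation of 0 in `D` rearranges into feasibility of ξ in the auxiliary economy for
      -- α.
      rintro ⟨ξ, α, hα, hξ, h⟩
      refine hnd α hα ⟨ξ, ⟨fun i => (hξ i).1.1, ?_⟩, fun i => (hξ i).1.2⟩
      change ∑ i, ξ i + E.c z = ∑ i, (α i • E.e i + (1 - α i) • (γ i + ρ i z • E.c z))
      have h1 : ∑ i, (α i • E.e i + (1 - α i) • (γ i + ρ i z • E.c z)) =
          ∑ i, ξ i + ∑ i, ρ i z • E.c z - ∑ i, (ξ i - γ i - α i • s i) := by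
        rw [← Finset.sum_add_distrib, ← Finset.sum_sub_distrib]
        refine Finset.sum_congr rfl fun i _ => ?_
        simp only [s]
        module
      rw [h1, ← h, ← Finset.sum_smul, hρ, one_smul, sub_zero])
    (by
      rintro d ⟨ξ, α, hα, hξ, rfl⟩ m hm hm0
      have hpi : ∀ i, 0 ≤ Pi.single (M := fun _ => B) i₀ m i ∧
          Pi.single (M := fun _ => B) i₀ m i ∈ idealSubmodule E.total := by
        intro i
        by_cases h : i = i₀
        · subst h
          simpa using ⟨hm0, hm⟩
        · simp [h]
      refine ⟨fun i => ξ i + Pi.single (M := fun _ => B) i₀ m i, α, hα, fun i =>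
        ⟨E.add_mem_preferred hE (hξ i).1 (hpi i).1, Submodule.add_mem _ (hξ i).2 (hpi i).2⟩, ?_⟩
      have h1 : ∑ i, Pi.single (M := fun _ => B) i₀ m i = m := by
        simp
      nth_rewrite 1 [← h1]
      rw [← Finset.sum_add_distrib]
      refine Finset.sum_congr rfl fun i _ => ?_
      beta_reduce
      abel)
  have hA : ∀ (ξ : Fin n → B) (α : Fin n → ℝ), (∀ i, α i ∈ Set.Icc (0 : ℝ) 1) →
      (∀ i, ξ i ∈ E.preferred i (x i) y z ∧ ξ i ∈ idealSubmodule E.total) →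
      0 ≤ ∑ i, (p (ξ i) - p (γ i) - α i * p (s i)) := by
    intro ξ α hα hξ
    have := hpD _ ⟨ξ, α, hα, hξ, rfl⟩
    simpa only [map_sum, map_sub, map_smul, smul_eq_mul] using this
  have hper : ∀ ε : ℝ, 0 < ε → ∀ i, γ i + ε • E.total ∈ E.preferred i (x i) y z ∧
      γ i + ε • E.total ∈ idealSubmodule E.total := fun ε hε i =>
    ⟨E.add_mem_preferred_of_le hE (hγ0 i) (hγu i) (smul_nonneg hε.le he)
      (smul_ne_zero hε.ne' he0), Submodule.add_mem _ (hγM i) (Submodule.smul_mem _ _ heM)⟩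
  have hn : (0 : ℝ) < n := by
    have := i₀.pos
    exact_mod_cast this
  -- With α the j-th unit vector and each ξ_i = γ_i + (ε/n) e, positivity on `D` reads p(s_j) ≤ ε.
  have hs_nonpos : ∀ j, p (s j) ≤ 0 := by
    intro j
    refine le_of_forall_pos_le_add fun ε hε => ?_
    have h1 := hA (fun i => γ i + (ε / n) • E.total) (Pi.single j 1) (by
      intro i
      by_cases h : i = j
      · subst h
        simp
      · simp [h]) (hper _ (div_pos hε hn))
    simp only [map_add, map_smul, hpe, smul_eq_mul, mul_one, add_sub_cancel_left,
      Finset.sum_sub_distrib, Finset.sum_const, Finset.card_univ, Fintype.card_fin,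
      nsmul_eq_mul] at h1
    rw [mul_div_cancel₀ _ hn.ne'] at h1
    have h2 : ∑ i, (Pi.single j 1 : Fin n → ℝ) i * p (s i) = p (s j) := by
      simp [Pi.single_apply]
    linarith
  have hs_zero : ∀ j, p (s j) = 0 := by
    have h1 : ∑ j, p (s j) = 0 := by rw [← map_sum, hs0, map_zero]
    intro j
    exact (Finset.sum_eq_zero_iff_of_nonpos fun j _ => hs_nonpos j).1 h1 j (Finset.mem_univ j)
  refine ⟨p, hpe, hpM, fun i => ?_, fun i ξ hξ hξM => ?_⟩
  · have := hs_zero i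
    simp only [s, map_sub, map_smul, smul_eq_mul] at this
    linarith
  · refine le_of_forall_pos_le_add fun ε hε => ?_
    have h1 := hA (fun j => if j = i then ξ else γ j + (ε / n) • E.total) 0
      (fun j => by simp) (fun j => by
        by_cases h : j = i
        · subst h
          simpa using ⟨hξ, hξM⟩
        · simpa [h] using hper _ (div_pos hε hn) j)
    have h2 : ∑ j, (p (if j = i then ξ else γ j + (ε / n) • E.total) - p (γ j) -
        (0 : Fin n → ℝ) j * p (s j)) ≤
        ∑ j, ((Pi.single i (p ξ - p (γ i)) : Fin n → ℝ) j + ε / n) := by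
      refine Finset.sum_le_sum fun j _ => ?_
      by_cases h : j = i
      · subst h
        simp only [if_true, Pi.single_eq_same, Pi.zero_apply, zero_mul, sub_zero]
        have := div_pos hε hn
        linarith
      · simp [h, hpe]
    rw [Finset.sum_add_distrib, Finset.sum_const, Finset.card_univ, Fintype.card_fin,
      nsmul_eq_mul, mul_div_cancel₀ _ hn.ne', Finset.sum_pi_single', if_pos (Finset.mem_univ i)]
      at h2
    linarith

variable [HasSolidNorm B]

/-- Under strong properness, the supporting price of an undominated allocation can be chosen
continuous. -/
lemma Economy.exists_continuous_price [Nonempty (Fin n)] {E : Economy n B Y}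
    (hE : E.IsAdmissible) {x : Fin n → B} {y z : Y} {ρ : Fin n → Y → ℝ} (hρ : ∑ i, ρ i z = 1)
    {γ : Fin n → B} (hγ : E.Feasible γ z) (hγu : ∀ i, E.u i (x i) y ≤ E.u i (γ i) z)
    (he0 : E.total ≠ 0) (hunit : E.NetEndowmentOrderUnit)
    (hprop : ∀ i, E.StronglyATYProperAt i (x i) y)
    (hnd : ∀ α : Fin n → ℝ, (∀ i, α i ∈ Set.Icc (0 : ℝ) 1) →
      ¬ (E.auxiliary ρ γ z α).ZDominated x y z) :
    ∃ π : B →L[ℝ] ℝ, (∀ a, 0 ≤ a → 0 ≤ π a) ∧ 0 < π (E.total - E.c z) ∧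
      ∀ i, ∀ ξ ∈ E.preferred i (x i) y z, π (E.e i) ≤ π ξ + ρ i z * π (E.c z) := by
  obtain ⟨p, hpe, hpM, hpγ, hpP⟩ := E.exists_linear_price hE hρ hγ hγu he0 hnd
  obtain ⟨hγ0, hγs⟩ := hγ
  have he : 0 ≤ E.total := Finset.sum_nonneg fun i _ => hE.endowment_nonneg i
  have hcγ : E.total - E.c z = ∑ i, γ i := by
    change ∑ i, E.e i - E.c z = _
    rw [← hγs, add_sub_cancel_right]
  have hγc : E.total - E.c z ≤ E.total := sub_le_self _ (hE.cost_nonneg z)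
  have hγe : ∀ i, γ i ≤ E.total := fun i => by
    rw [hcγ] at hγc
    exact (Finset.single_le_sum (f := γ) (fun j _ => hγ0 j) (Finset.mem_univ i)).trans hγc
  have hce : E.c z ≤ E.total := by
    rw [← sub_nonneg, hcγ]
    exact Finset.sum_nonneg fun i _ => hγ0 i
  have hg : ∀ i, ∃ g : B →L[ℝ] ℝ, (∀ q ∈ E.preferred i (x i) y z, g (γ i) ≤ g q) ∧
      (∀ k ∈ principalIdeal E.total, 0 ≤ k → g k ≤ p k) ∧ g (γ i) = p (γ i) := by
    intro i
    obtain ⟨Q, hQ, -, hQP, hQne⟩ := hprop i z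
    have hPQ : E.preferred i (x i) y z ⊆ Q := hQP ▸ Set.inter_subset_left
    obtain ⟨g, h1, h2, h3⟩ := exists_continuous_support (idealSubmodule E.total) p hQ hQne
      (x := γ i) (by
        refine mem_closure_of_tendsto (f := fun t : ℝ => γ i + t • E.total)
          (b := nhdsWithin 0 (Set.Ioi 0)) ?_ ?_
        · have : Filter.Tendsto (fun t : ℝ => γ i + t • E.total) (nhds 0)
              (nhds (γ i + (0 : ℝ) • E.total)) :=
            Continuous.tendsto (by fun_prop) 0
          rw [zero_smul, add_zero] at this
          exact this.mono_left nhdsWithin_le_nhds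
        · filter_upwards [self_mem_nhdsWithin] with t ht
          exact hPQ (E.add_mem_preferred_of_le hE (hγ0 i) (hγu i)
            (smul_nonneg (le_of_lt ht) he) (smul_ne_zero (ne_of_gt ht) he0)))
      (hγ0 i) (mem_principalIdeal_of_le (self_mem_principalIdeal _) (hγ0 i) (hγe i))
      (by
        intro k hkQ hkM hk0
        exact hpP i k (hQP ▸ ⟨hkQ, hk0⟩) hkM)
    exact ⟨g, fun q hq => h1 q (hPQ hq), h2, h3⟩
  choose g hgP hgp hgγ using hg
  have hg0 : ∀ i a, 0 ≤ a → 0 ≤ g i a := by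
    intro i a ha
    rcases eq_or_ne a 0 with rfl | ha0
    · simp
    · have := hgP i _ (E.add_mem_preferred_of_le hE (hγ0 i) (hγu i) ha ha0)
      rw [map_add] at this
      linarith
  obtain ⟨π, hπ0, hπg, hπp⟩ := exists_upper_bound_le (principalIdeal E.total)
    (fun a ha b => mem_principalIdeal_of_le ha) p hpM Finset.univ g (fun i _ => hg0 i)
    (fun i _ => hgp i)
  obtain ⟨δ, hδ, hδe⟩ := hunit z
  have hle : ∀ b, 0 ≤ b → b ≤ E.total → π b ≤ p b := fun b hb hbe =>
    hπp b (mem_principalIdeal_of_le (self_mem_principalIdeal _) hb hbe) hb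
  -- π ≥ p at e - c(z) = Σγ_i, while π ≤ p at e - c(z) - δe; subtracting leaves δe.
  have hpe_le : p E.total ≤ π E.total := by
    have h1 : p (E.total - E.c z) ≤ π (E.total - E.c z) := by
      rw [hcγ, map_sum, map_sum]
      exact Finset.sum_le_sum fun i _ => hgγ i ▸ hπg i (Finset.mem_univ i) _ (hγ0 i)
    have h2 := hle (E.total - E.c z - δ • E.total) (sub_nonneg.2 hδe)
      ((sub_le_self _ (smul_nonneg hδ.le he)).trans hγc)
    rw [map_sub π, map_sub p, map_smul, map_smul, smul_eq_mul, smul_eq_mul] at h2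
    have h3 : δ * p E.total ≤ δ * π E.total := by linarith
    exact le_of_mul_le_mul_left h3 hδ
  -- π ≤ p at both b and e - b, with no gap left at their sum.
  have heq : ∀ b, 0 ≤ b → b ≤ E.total → π b = p b := by
    intro b hb hbe
    have h1 := hle b hb hbe
    have h2 := hle (E.total - b) (sub_nonneg.2 hbe) (sub_le_self _ hb)
    rw [map_sub π, map_sub p] at h2
    linarith
  refine ⟨π, hπ0, ?_, fun i ξ hξ => ?_⟩
  · have h1 := hπ0 _ (sub_nonneg.2 hδe)
    rw [map_sub, map_smul, smul_eq_mul, heq _ he le_rfl, hpe] at h1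
    linarith
  · have h1 := hπg i (Finset.mem_univ i) ξ hξ.1
    have h2 := hgP i ξ hξ
    rw [hgγ] at h2
    have h3 := hpγ i
    rw [← heq _ (hE.cost_nonneg z) hce, ← heq _ (hE.endowment_nonneg i)
      (Finset.single_le_sum (f := E.e) (fun j _ => hE.endowment_nonneg j) (Finset.mem_univ i))] at h3
    linarith

end Pricing

end PublicProjects

namespace PublicProjects

/-! ### Budget identities, strict support, and the reduction of the three regimes. -/

section Equilibrium

set_option linter.unusedSectionVars false

variable {n : ℕ} {B Y : Type*} [NormedAddCommGroup B] [Lattice B] [IsOrderedAddMonoid B]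
  [HasSolidNorm B] [NormedSpace ℝ B] [IsOrderedModule ℝ B]

lemma eq_zero_of_abs_nonpos {v : B} (h : |v| ≤ 0) : v = 0 :=
  le_antisymm ((le_abs_self v).trans h) (neg_nonpos.1 ((neg_le_abs v).trans h))

lemma IsContributionMeasure.sum_costShare [Nonempty (Fin n)] {σ : Finset (Fin n) → Y → ℝ}
    (hσ : IsContributionMeasure σ) (z : Y) : ∑ i, costShare σ i z = 1 := by
  have key : ∀ S : Finset (Fin n), S.Nonempty → σ S z = ∑ i ∈ S, costShare σ i z := by
    intro S hS
    induction hS using Finset.Nonempty.cons_induction with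
    | singleton a => simp [costShare]
    | cons a s ha hs ih =>
      rw [Finset.sum_cons, ← ih, Finset.cons_eq_insert, Finset.insert_eq]
      exact hσ.additive _ _ (Finset.singleton_nonempty a) hs
        (Finset.disjoint_singleton_left.2 ha) z
  rw [← key _ Finset.univ_nonempty, hσ.univ]

/-- If every preferred bundle is too expensive, then a feasible allocation that is weakly preferred
by everybody exhausts all budgets. -/
lemma Economy.budget_eq_of_feasible [Nontrivial B] {E : Economy n B Y} (hE : E.IsAdmissible)
    {x : Fin n → B} {y z : Y} {ρ : Fin n → Y → ℝ} (hρ : ∑ i, ρ i z = 1) {η : Fin n → B}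
    (hη : E.Feasible η z) (hηu : ∀ i, E.u i (x i) y ≤ E.u i (η i) z) (π : B →L[ℝ] ℝ)
    (hπ : ∀ i, ∀ ξ ∈ E.preferred i (x i) y z, π (E.e i) ≤ π ξ + ρ i z * π (E.c z)) (i : Fin n) :
    π (η i) + ρ i z * π (E.c z) = π (E.e i) := by
  obtain ⟨v, hv0⟩ := exists_ne (0 : B)
  have hv : |v| ≠ 0 := fun h => hv0 (eq_zero_of_abs_nonpos h.le)
  have hle : ∀ j, π (E.e j) ≤ π (η j) + ρ j z * π (E.c z) := by
    intro j
    have h1 : Filter.Tendsto (fun t : ℝ => π (η j + t • |v|) + ρ j z * π (E.c z))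
        (nhdsWithin 0 (Set.Ioi 0)) (nhds (π (η j + (0 : ℝ) • |v|) + ρ j z * π (E.c z))) :=
      (Continuous.tendsto (by fun_prop) 0).mono_left nhdsWithin_le_nhds
    rw [zero_smul, add_zero] at h1
    refine ge_of_tendsto h1 ?_
    filter_upwards [self_mem_nhdsWithin] with t ht
    exact hπ j _ (E.add_mem_preferred_of_le hE (hη.1 j) (hηu j)
      (smul_nonneg (le_of_lt ht) (abs_nonneg v)) (smul_ne_zero (ne_of_gt ht) hv))
  have hsum : ∑ j, π (E.e j) = ∑ j, (π (η j) + ρ j z * π (E.c z)) := by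
    rw [Finset.sum_add_distrib, ← Finset.sum_mul, hρ, one_mul, ← map_sum, ← map_sum, ← hη.2,
      map_add]
  exact ((Finset.sum_eq_sum_iff_of_le fun j _ => hle j).1 hsum i (Finset.mem_univ i)).symm

/-- Weakly supporting prices that give a positive value to the net endowment are strictly
supporting. -/
lemma Economy.lt_of_mem_preferred [Nontrivial B] {E : Economy n B Y} (hE : E.IsAdmissible)
    (hess : E.Essentiality) {x : Fin n → B} {y z : Y} (hx : ∀ i, 0 ≤ x i) {ρ : Fin n → Y → ℝ}
    (hρ : ∑ i, ρ i z = 1) {γ : Fin n → B} (hγ : E.Feasible γ z)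
    (hγu : ∀ i, E.u i (x i) y ≤ E.u i (γ i) z) {π : B →L[ℝ] ℝ} (hπ0 : ∀ a, 0 ≤ a → 0 ≤ π a)
    (hpos : 0 < π (E.total - E.c z))
    (hπ : ∀ i, ∀ ξ ∈ E.preferred i (x i) y z, π (E.e i) ≤ π ξ + ρ i z * π (E.c z))
    {i : Fin n} {ξ : B} (hξ : ξ ∈ E.preferred i (x i) y z) :
    π (E.e i) < π ξ + ρ i z * π (E.c z) := by
  -- A slight scaling down of ζ is still preferred by continuity, and strictly cheaper.
  have hstrict : ∀ j, ∀ ζ ∈ E.preferred j (x j) y z, 0 < π ζ →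
      π (E.e j) < π ζ + ρ j z * π (E.c z) := by
    intro j ζ hζ hpζ
    have h1 : Filter.Tendsto (fun t : ℝ => (1 - t) • ζ) (nhdsWithin 0 (Set.Ioc 0 1))
        (nhdsWithin ζ (Set.Ici 0)) := by
      refine tendsto_nhdsWithin_iff.2 ⟨?_, ?_⟩
      · have : Filter.Tendsto (fun t : ℝ => (1 - t) • ζ) (nhds 0) (nhds ((1 - (0 : ℝ)) • ζ)) :=
          Continuous.tendsto (by fun_prop) 0
        rw [sub_zero, one_smul] at this
        exact this.mono_left nhdsWithin_le_nhds
      · filter_upwards [self_mem_nhdsWithin] with t ht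
        exact smul_nonneg (sub_nonneg.2 ht.2) hζ.1
    have h2 := ((hE.continuous j z ζ hζ.1).tendsto.comp h1).eventually (lt_mem_nhds hζ.2)
    have hne : (nhdsWithin (0 : ℝ) (Set.Ioc 0 1)).NeBot := by
      rw [nhdsWithin_Ioc_eq_nhdsGT zero_lt_one]
      infer_instance
    obtain ⟨t, ht, h3⟩ := (h2.and self_mem_nhdsWithin).exists
    have h4 := hπ j ((1 - t) • ζ) ⟨smul_nonneg (sub_nonneg.2 h3.2) hζ.1, ht⟩
    rw [map_smul, smul_eq_mul] at h4
    have := mul_pos h3.1 hpζ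
    linarith
  have heq := E.budget_eq_of_feasible hE hρ hγ hγu π hπ
  have hγpos : ∃ j ∈ Finset.univ, 0 < π (γ j) := by
    refine Finset.exists_lt_of_sum_lt (f := fun _ => (0 : ℝ)) ?_
    have : E.total - E.c z = ∑ i, γ i := by
      change ∑ i, E.e i - E.c z = _
      rw [← hγ.2, add_sub_cancel_right]
    rwa [Finset.sum_const_zero, ← map_sum, ← this]
  obtain ⟨j, -, hj⟩ := hγpos
  -- The price is strictly positive: agent `j`, whose γ_j has positive value, strictly prefers γ_j +
  -- v.
  have hπpos : ∀ v, 0 ≤ v → v ≠ 0 → 0 < π v := by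
    intro v hv hv0
    have h1 := hstrict j _ (E.add_mem_preferred_of_le hE (hγ.1 j) (hγu j) hv hv0) (by
      rw [map_add]
      linarith [hπ0 v hv])
    rw [map_add] at h1
    linarith [heq j]
  refine hstrict i ξ hξ (hπpos ξ hξ.1 ?_)
  rintro rfl
  exact absurd hξ.2 (not_lt.2 (hess.indispensability i (x i) y z (hx i)))

lemma zero_notMem_interior_Ici [Nontrivial B] : (0 : B) ∉ interior (Set.Ici (0 : B)) := by
  intro h
  obtain ⟨v, hv0⟩ := exists_ne (0 : B)
  have h1 : Filter.Tendsto (fun t : ℝ => t • (-|v|)) (nhdsWithin 0 (Set.Ioi 0)) (nhds 0) := by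
    have : Filter.Tendsto (fun t : ℝ => t • (-|v|)) (nhds 0) (nhds ((0 : ℝ) • (-|v|))) :=
      Continuous.tendsto (by fun_prop) 0
    rw [zero_smul] at this
    exact this.mono_left nhdsWithin_le_nhds
  obtain ⟨t, ht, ht0⟩ :=
    ((h1.eventually (mem_interior_iff_mem_nhds.1 h)).and self_mem_nhdsWithin).exists
  have h2 : (0 : B) ≤ t • (-|v|) := ht
  have h3 := smul_le_smul_of_nonneg_left h2 (inv_nonneg.2 (le_of_lt ht0))
  rw [smul_zero, inv_smul_smul₀ (ne_of_gt ht0), neg_nonneg] at h3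
  exact hv0 (eq_zero_of_abs_nonpos h3)

/-- Interior points of the cone dominate small multiples of arbitrary vectors. -/
lemma exists_pos_smul_le_of_mem_interior {a : B} (ha : a ∈ interior (Set.Ici (0 : B))) (b : B) :
    ∃ t : ℝ, 0 < t ∧ t • b ≤ a := by
  have h1 : Filter.Tendsto (fun t : ℝ => a - t • b) (nhdsWithin 0 (Set.Ioi 0)) (nhds a) := by
    have : Filter.Tendsto (fun t : ℝ => a - t • b) (nhds 0) (nhds (a - (0 : ℝ) • b)) :=
      Continuous.tendsto (by fun_prop) 0
    rw [zero_smul, sub_zero] at this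
    exact this.mono_left nhdsWithin_le_nhds
  obtain ⟨t, ht, ht0⟩ :=
    ((h1.eventually (mem_interior_iff_mem_nhds.1 ha)).and self_mem_nhdsWithin).exists
  exact ⟨t, ht0, sub_nonneg.1 ht⟩

lemma mem_principalIdeal_of_mem_interior {e : B} (he : e ∈ interior (Set.Ici (0 : B))) (v : B) :
    v ∈ principalIdeal e := by
  obtain ⟨t, ht, h⟩ := exists_pos_smul_le_of_mem_interior he |v|
  refine ⟨t⁻¹, inv_nonneg.2 ht.le, ?_⟩
  rw [le_inv_smul_iff_of_pos ht]
  exact h.trans (le_abs_self e)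

/-- In each of the three regimes, preferences are strongly proper at Pareto optimal allocations
and net endowments are order units of the ideal of the total endowment. -/
lemma Economy.Regime.stronglyATYProperAt [Nontrivial B] {E : Economy n B Y} (hE : E.IsAdmissible)
    (hreg : E.Regime) {x : Fin n → B} {y : Y} (hx : E.ParetoOptimal x y) {γ : Y → Fin n → B}
    (hγ : ∀ z, E.Feasible (γ z) z) (hγu : ∀ z i, E.u i (x i) y ≤ E.u i (γ z i) z) :
    E.NetEndowmentOrderUnit ∧ ∀ i, E.StronglyATYProperAt i (x i) y := by
  rcases hreg with ⟨-, he, hec⟩ | ⟨-, ⟨-, he⟩, hunit, hprop⟩ | ⟨-, hunit, hprop⟩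
  · refine ⟨fun z => exists_pos_smul_le_of_mem_interior (hec z) _, fun i z => ?_⟩
    -- By monotonicity the preferred set contains a translate of the open cone, so it serves as its
    -- own properness set.
    have hsub : (fun v => γ z i + v) '' interior (Set.Ici (0 : B)) ⊆
        interior (E.preferred i (x i) y z) := by
      refine interior_maximal ?_ ((isOpenMap_add_left (γ z i)) _ isOpen_interior)
      rintro _ ⟨v, hv, rfl⟩
      refine E.add_mem_preferred_of_le hE ((hγ z).1 i) (hγu z i) (interior_subset hv) ?_
      rintro rfl
      exact zero_notMem_interior_Ici hv
    have hmem : γ z i + E.total ∈ interior (E.preferred i (x i) y z) := hsub ⟨_, he, rfl⟩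
    exact ⟨E.preferred i (x i) y z, E.preferred_convex hE i (x i) y z, ⟨_, hmem⟩,
      Set.inter_eq_left.2 fun ζ hζ => hζ.1, _, ⟨hmem, (interior_subset hmem).1⟩,
      mem_principalIdeal_of_mem_interior he _⟩
  · refine ⟨hunit, fun i z => ?_⟩
    obtain ⟨P, h1, h2, h3, q, hqP, hq0⟩ := hprop x y hx i z
    refine ⟨P, h1, h2, h3, ?_⟩
    -- Density supplies an element of the ideal that need not be positive; its positive part stays
    -- in the ideal.
    have hopen : IsOpen ((fun v : B => v⁺) ⁻¹' interior P) :=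
      isOpen_interior.preimage continuous_posPart
    obtain ⟨v, hv, hvP⟩ := he.exists_mem_open hopen ⟨q, by
      simpa [posPart_eq_self.2 (show 0 ≤ q from hq0)] using hqP⟩
    refine ⟨v⁺, ⟨hvP, posPart_nonneg v⟩, ?_⟩
    obtain ⟨k, hk, hvk⟩ := hv
    refine ⟨k, hk, le_trans ?_ hvk⟩
    rw [abs_of_nonneg (posPart_nonneg v)]
    exact sup_le (le_abs_self v) (abs_nonneg v)
  · exact ⟨hunit, hprop x y hx⟩

end Equilibrium

end PublicProjects

/-! ### The equivalence. -/

theorem theorem4 {n : ℕ} {B Y : Type*}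
    [NormedAddCommGroup B] [Lattice B] [IsOrderedAddMonoid B] [HasSolidNorm B]
    [NormedSpace ℝ B] [IsOrderedModule ℝ B] [CompleteSpace B]
    (E : PublicProjects.Economy n B Y)
    (hE : E.IsAdmissible) (hess : E.Essentiality) (hreg : E.Regime)
    (σ : Finset (Fin n) → Y → ℝ) (hσ : PublicProjects.IsContributionMeasure σ)
    (x : Fin n → B) (y : Y) (hx : E.ParetoOptimal x y)
    (γ : Y → Fin n → B) (hγ : ∀ z, E.Feasible (γ z) z)
    (hγu : ∀ z i, E.u i (x i) y ≤ E.u i (γ z i) z) :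
    E.IsCostShareEquilibrium (PublicProjects.costShare σ) x y ↔
      ∀ (z : Y) (α : Fin n → ℝ), (∀ i, α i ∈ Set.Icc (0 : ℝ) 1) →
        ¬ (E.auxiliary (PublicProjects.costShare σ) (γ z) z α).ZDominated x y z := by
  have hn : Nonempty (Fin n) := by
    by_contra h
    rw [not_nonempty_iff] at h
    exact hx.2 ⟨x, y, hx.1, fun i => h.elim i⟩
  have hρ := hσ.sum_costShare
  -- In the zero space monotonicity is vacuous, but indispensability alone makes both sides true.
  rcases subsingleton_or_nontrivial B with hB | hB
  · have hu : ∀ i (ξ : B) z, E.u i ξ z ≤ E.u i (x i) y := fun i ξ z => by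
      rw [Subsingleton.elim ξ 0]
      exact hess.indispensability i (x i) y z (hx.1.1 i)
    refine iff_of_true ⟨hx.1, 0, by simp, fun i => ⟨⟨hx.1.1 i, by simp⟩, fun p _ => hu i _ _⟩⟩ ?_
    rintro z α - ⟨ξ, -, hξ⟩
    obtain ⟨i⟩ := hn
    exact absurd (hξ i) (not_lt.2 (hu i _ _))
  · constructor
    · rintro ⟨-, π, hπ0, hπ⟩ z α - ⟨ξ, ⟨hξ0, hξs⟩, hξu⟩
      have hlt : ∀ i, ∀ ζ ∈ E.preferred i (x i) y z,
          π z (E.e i) < π z ζ + PublicProjects.costShare σ i z * π z (E.c z) := by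
        intro i ζ hζ
        by_contra! h
        exact absurd ((hπ i).2 (ζ, z) ⟨hζ.1, h⟩) (not_le.2 hζ.2)
      have heq := E.budget_eq_of_feasible hE (hρ z) (hγ z) (hγu z) (π z)
        fun i ζ hζ => (hlt i ζ hζ).le
      have h1 := congrArg (π z) hξs
      change π z (∑ i, ξ i + E.c z) =
        π z (∑ i, (α i • E.e i + (1 - α i) • (γ z i + PublicProjects.costShare σ i z • E.c z))) at h1
      have h2 : ∀ i, π z (α i • E.e i + (1 - α i) • (γ z i + PublicProjects.costShare σ i z • E.c z)) =
          π z (E.e i) := by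
        intro i
        rw [map_add, map_smul, map_smul, map_add, map_smul]
        simp only [smul_eq_mul]
        rw [heq i]
        ring
      rw [map_sum, Finset.sum_congr rfl fun i _ => h2 i, map_add, map_sum] at h1
      have h3 := Finset.sum_lt_sum_of_nonempty Finset.univ_nonempty
        fun i _ => hlt i (ξ i) ⟨hξ0 i, hξu i⟩
      rw [Finset.sum_add_distrib, ← Finset.sum_mul, hρ, one_mul] at h3
      linarith
    · intro hnd
      obtain ⟨hunit, hprop⟩ := hreg.stronglyATYProperAt hE hx hγ hγu
      -- If `e` were 0, strong properness would make the bundle 0 strictly preferred, against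
      -- indispensability.
      have he0 : E.total ≠ 0 := by
        intro h0
        obtain ⟨i⟩ := hn
        obtain ⟨P, -, -, hP, w, ⟨hwP, hw0⟩, k, -, hk⟩ := hprop i y
        rw [h0, abs_zero, smul_zero] at hk
        have hw : w = 0 := PublicProjects.eq_zero_of_abs_nonpos hk
        have : w ∈ E.preferred i (x i) y y := hP ▸ ⟨interior_subset hwP, hw0⟩
        rw [hw] at this
        exact absurd this.2 (not_lt.2 (hess.indispensability i (x i) y y (hx.1.1 i)))
      choose π hπ0 hπpos hπ using fun z =>
        E.exists_continuous_price hE (hρ z) (hγ z) (hγu z) he0 hunit hprop (hnd z)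
      refine ⟨hx.1, π, hπ0, fun i => ⟨⟨hx.1.1 i, ?_⟩, ?_⟩⟩
      -- Here the budget identity is applied to `x` itself, not to γ^y.
      · exact (E.budget_eq_of_feasible hE (hρ y) hx.1 (fun _ => le_rfl) (π y) (hπ y) i).le
      · rintro ⟨ζ, z⟩ ⟨hζ0, hζ⟩
        by_contra! h
        exact absurd (E.lt_of_mem_preferred hE hess hx.1.1 (hρ z) (hγ z) (hγu z) (hπ0 z)
          (hπpos z) (hπ z) ⟨hζ0, h⟩) (not_lt.2 hζ)
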